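/- Let $M$ be a smooth (Hausdorff) manifold of dimension $2n+1$ with a smooth almost contact metric structure $(\varphi,\xi,\eta,g)$: $g$ is a Riemannian metric, $\varphi$ a $(1,1)$-tensor field, $\xi$ a vector field and $\eta$ a 1-form such that $$\varphi^2=-I+\eta\otimes\xi,\quad \eta(\xi)=1,\quad \eta\circ\varphi=0,\quad \varphi(\xi)=0,\quad \eta(X)=g(X,\xi),\quad g(\varphi X,\varphi Y)=g(X,Y)-\eta(X)\eta(Y)$$ for all vector fields $X,Y$. Let $\nabla$ be the Levi-Civita connection of $g$, let $R(X,Y)Z=\nabla_X\nabla_YZ-\nabla_Y\nabla_XZ-\nabla_{[X,Y]}Z$, and let $S(Y,Z)=\operatorname{tr}(X\mapsto R(X,Y)Z)$ be the Ricci tensor. Suppose that $M$ is $\beta$-Kenmotsu for a real constant $\beta>0$, that is, $$(\nabla_X\varphi)(Y)=\beta\,\bigl(g(\varphi X,Y)\,\xi-\eta(Y)\,\varphi X\bigr)\quad\text{for all vector fields } X,Y,$$ and that $M$ is special weakly Ricci symmetric, that is, there is a smooth 1-form $\rho$ with $$(\nabla_XS)(Y,Z)=2\rho(X)S(Y,Z)+\rho(Y)S(Z,X)+\rho(Z)S(X,Y)\quad\text{for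 all vector fields } X,Y,Z.$$ Then $M$ is an Einstein space, i.e. there is a real constant $c$ with $S=c\,g$. Moreover $\nabla S=0$, and if $n\ge 1$ then every such $\rho$ vanishes identically. -/

import Mathlib

open Bundle Manifold Module
open scoped ContDiff

noncomputable section

namespace Kenmotsu

section

variable {E : Type*} [NormedAddCommGroup E] [NormedSpace ℝ E]
  {H : Type*} [TopologicalSpace H] (I : ModelWithCorners ℝ E H)
  {M : Type*} [TopologicalSpace M] [ChartedSpace H M] [IsManifold I ∞ M]

/-- The vector field `X` is of class `C^∞`, i.e. `X ∈ 𝒳(M)`. -/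
def SmoothField (X : ∀ x : M, TangentSpace I x) : Prop :=
  ContMDiff I (I.prod 𝓘(ℝ, E)) ∞
    (fun x ↦ TotalSpace.mk' E (E := (TangentSpace I : M → Type _)) x (X x))

/-- The `1`-form `α` is of class `C^∞`. -/
def SmoothForm (α : ∀ x : M, TangentSpace I x →L[ℝ] ℝ) : Prop :=
  ContMDiff I (I.prod 𝓘(ℝ, E →L[ℝ] ℝ)) ∞
    (fun x ↦ TotalSpace.mk' (E →L[ℝ] ℝ)
      (E := fun x : M ↦ TangentSpace I x →L[ℝ] ℝ) x (α x))

/-- The `(1,1)`-tensor field `A` is of class `C^∞`. -/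
def SmoothEndo (A : ∀ x : M, TangentSpace I x →L[ℝ] TangentSpace I x) : Prop :=
  ContMDiff I (I.prod 𝓘(ℝ, E →L[ℝ] E)) ∞
    (fun x ↦ TotalSpace.mk' (E →L[ℝ] E)
      (E := fun x : M ↦ TangentSpace I x →L[ℝ] TangentSpace I x) x (A x))

variable [RiemannianBundle (fun x : M ↦ TangentSpace I x)]

variable (M) in
/-- An almost contact metric structure `(φ, ξ, η, g)` on `M`, where `g` is the given Riemannian
metric on `M`, written `inner ℝ`. -/
structure AlmostContactMetric where
  /-- the `(1,1)`-tensor field `φ` -/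
  phi : ∀ x : M, TangentSpace I x →L[ℝ] TangentSpace I x
  /-- the vector field `ξ` -/
  xi : ∀ x : M, TangentSpace I x
  /-- the `1`-form `η` -/
  eta : ∀ x : M, TangentSpace I x →L[ℝ] ℝ
  smooth_phi : SmoothEndo I phi
  smooth_xi : SmoothField I xi
  smooth_eta : SmoothForm I eta
  phi_phi : ∀ (x : M) (u : TangentSpace I x), phi x (phi x u) = -u + eta x u • xi x
  eta_xi : ∀ x : M, eta x (xi x) = 1
  eta_phi : ∀ (x : M) (u : TangentSpace I x), eta x (phi x u) = 0
  phi_xi : ∀ x : M, phi x (xi x) = 0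
  eta_eq : ∀ (x : M) (u : TangentSpace I x), eta x u = inner ℝ u (xi x)
  inner_phi_phi : ∀ (x : M) (u v : TangentSpace I x),
    inner ℝ (phi x u) (phi x v) = inner ℝ u v - eta x u * eta x v

variable {I}

/-- `∇_X Y` for an affine connection `∇` on `M`. -/
def nabla (D : CovariantDerivative I E (TangentSpace I : M → Type _))
    (X Y : ∀ x : M, TangentSpace I x) : ∀ x : M, TangentSpace I x :=
  fun x ↦ D Y x (X x)

/-- `R(X, Y) Z = ∇_X ∇_Y Z - ∇_Y ∇_X Z - ∇_[X, Y] Z` on vector fields. -/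
def curvature (D : CovariantDerivative I E (TangentSpace I : M → Type _))
    (X Y Z : ∀ x : M, TangentSpace I x) : ∀ x : M, TangentSpace I x :=
  nabla D X (nabla D Y Z) - nabla D Y (nabla D X Z)
    - nabla D (VectorField.mlieBracket I X Y) Z

/-- The value `R(u, v) w` of the curvature tensor on tangent vectors at `x`, computed with the
extensions `FiberBundle.extend` of `u, v, w`, which are smooth near `x`. -/
def curvatureAt (D : CovariantDerivative I E (TangentSpace I : M → Type _))
    (x : M) (u v w : TangentSpace I x) : TangentSpace I x :=
  curvature D (FiberBundle.extend E u) (FiberBundle.extend E v) (FiberBundle.extend E w) x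

variable [FiniteDimensional ℝ E]

instance (x : M) : FiniteDimensional ℝ (TangentSpace I x) :=
  inferInstanceAs (FiniteDimensional ℝ E)

/-- The Ricci tensor `S(v, w)`, the trace of `u ↦ R(u, v) w`, computed in an orthonormal basis of
the tangent space at `x`. -/
def ricci (D : CovariantDerivative I E (TangentSpace I : M → Type _))
    (x : M) (v w : TangentSpace I x) : ℝ :=
  ∑ i, inner ℝ (curvatureAt D x (stdOrthonormalBasis ℝ (TangentSpace I x) i) v w)
    (stdOrthonormalBasis ℝ (TangentSpace I x) i)

/-- `(∇_X S)(Y, Z) = X(S(Y, Z)) - S(∇_X Y, Z) - S(Y, ∇_X Z)`, with `S` the Ricci tensor. -/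
def nablaRicci (D : CovariantDerivative I E (TangentSpace I : M → Type _))
    (X Y Z : ∀ x : M, TangentSpace I x) (x : M) : ℝ :=
  mvfderiv I (fun y ↦ ricci D y (Y y) (Z y)) x (X x)
    - ricci D x (nabla D X Y x) (Z x) - ricci D x (Y x) (nabla D X Z x)

/-- The Ricci tensor is parallel, `∇S = 0`. -/
def RicciParallel (D : CovariantDerivative I E (TangentSpace I : M → Type _)) : Prop :=
  ∀ X Y Z : ∀ x : M, TangentSpace I x, SmoothField I X → SmoothField I Y → SmoothField I Z →
    ∀ x, nablaRicci D X Y Z x = 0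

/-- `M` is special weakly Ricci symmetric with respect to the `1`-form `ρ`. -/
def SpecialWeaklyRicciSymmetric
    (D : CovariantDerivative I E (TangentSpace I : M → Type _))
    (ρ : ∀ x : M, TangentSpace I x →L[ℝ] ℝ) : Prop :=
  SmoothForm I ρ ∧
  ∀ X Y Z : ∀ x : M, TangentSpace I x, SmoothField I X → SmoothField I Y → SmoothField I Z →
    ∀ x, nablaRicci D X Y Z x =
      2 * ρ x (X x) * ricci D x (Y x) (Z x) + ρ x (Y x) * ricci D x (Z x) (X x)
        + ρ x (Z x) * ricci D x (X x) (Y x)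

/-- `M` is an Einstein space: the Ricci tensor is a constant multiple of the metric. -/
def IsEinstein (D : CovariantDerivative I E (TangentSpace I : M → Type _)) : Prop :=
  ∃ c : ℝ, ∀ (x : M) (u v : TangentSpace I x), ricci D x u v = c * inner ℝ u v

/-- `D` is the Levi-Civita connection of the metric: the affine connection (taking smooth fields
to smooth fields) that is torsion-free and compatible with the metric. -/
structure IsLeviCivita [CompleteSpace E]
    (D : CovariantDerivative I E (TangentSpace I : M → Type _)) : Prop where
  smooth : CovariantDerivative.ContMDiffCovariantDerivative D ∞
  torsion_free : D.torsion = 0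
  metric : ∀ (x : M) (v : TangentSpace I x) (Y Z : ∀ x : M, TangentSpace I x),
    MDifferentiableAt I (I.prod 𝓘(ℝ, E))
      (fun y ↦ TotalSpace.mk' E (E := (TangentSpace I : M → Type _)) y (Y y)) x →
    MDifferentiableAt I (I.prod 𝓘(ℝ, E))
      (fun y ↦ TotalSpace.mk' E (E := (TangentSpace I : M → Type _)) y (Z y)) x →
    mvfderiv I (fun y ↦ (inner ℝ (Y y) (Z y) : ℝ)) x v =
      inner ℝ (D Y x v) (Z x) + inner ℝ (Y x) (D Z x v)

/-- `f`-Kenmotsu manifolds: `f` is smooth, strictly positive, `df ∧ η = 0`, and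
`(∇_X φ)(Y) = f (g(φ X, Y) ξ - η(Y) φ X)` for the Levi-Civita connection. -/
structure IsFKenmotsu [CompleteSpace E]
    (D : CovariantDerivative I E (TangentSpace I : M → Type _))
    (A : AlmostContactMetric I M) (f : M → ℝ) : Prop where
  leviCivita : IsLeviCivita D
  smooth_f : ContMDiff I 𝓘(ℝ, ℝ) ∞ f
  pos : ∀ x, 0 < f x
  wedge : ∀ (x : M) (u v : TangentSpace I x),
    mvfderiv I f x u * A.eta x v - mvfderiv I f x v * A.eta x u = 0
  nabla_phi : ∀ X Y : ∀ x : M, TangentSpace I x, SmoothField I X → SmoothField I Y →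
    ∀ x, nabla D X (fun y ↦ A.phi y (Y y)) x - A.phi x (nabla D X Y x) =
      f x • ((inner ℝ (A.phi x (X x)) (Y x) : ℝ) • A.xi x - A.eta x (Y x) • A.phi x (X x))

/-- `β`-Kenmotsu manifolds: `f`-Kenmotsu manifolds with `f` the constant `β > 0`. -/
def IsBetaKenmotsu [CompleteSpace E]
    (D : CovariantDerivative I E (TangentSpace I : M → Type _))
    (A : AlmostContactMetric I M) (β : ℝ) : Prop :=
  0 < β ∧ IsFKenmotsu D A (fun _ ↦ β)

end

end Kenmotsu

end

/-! ### Smooth fields and the curvature of a metric connection. -/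

noncomputable section

namespace Kenmotsu

open scoped Topology

section

variable {E : Type*} [NormedAddCommGroup E] [NormedSpace ℝ E]
  {H : Type*} [TopologicalSpace H] {I : ModelWithCorners ℝ E H}
  {M : Type*} [TopologicalSpace M] [ChartedSpace H M] [IsManifold I ∞ M]
  {X Y Z W : ∀ x : M, TangentSpace I x}

/-! The `φ`-equation with `Y = ξ` gives `∇_v ξ = β (v - η(v) ξ)`. Hence `R(X, Y) ξ = β² (η(X) Y -
η(Y) X)`, whose trace is `S(v, ξ) = -2nβ² η(v)`. Differentiating this yields `(∇_X S)(Y, ξ) = -2nβ³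
g(X, Y) - β S(Y, X)` (`nablaRicci_xi`), which vanishes for `X = ξ`. For `n ≥ 1` the symmetry
condition at `(ξ, ξ, ξ)` and then at `(ξ, V, ξ)` therefore forces `ρ(ξ) = 0` and `ρ(V) = 0`. So `∇S
= 0`, and the same formula gives `S = -2nβ² g`. For `n = 0`, `ξ` spans the tangent line and `S(v, ξ)
= 0`, so `S = 0`.

The curvature at a point is defined through chosen extensions, so its tensoriality in the third slot
has to be proved. It follows from skew-adjointness: `⟨R(u, v) w, z⟩ = -⟨w, R(u, v) z⟩` sees `w` only
through its value. -/

lemma SmoothField.mdifferentiableAt (hX : SmoothField I X) (x : M) : MDiffAt (T% X) x :=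
  ContMDiffAt.mdifferentiableAt (n := ∞) (hX x) (by simp)

lemma SmoothField.sub (hX : SmoothField I X) (hY : SmoothField I Y) : SmoothField I (X - Y) :=
  ContMDiff.sub_section hX hY

lemma SmoothField.smul {f : M → ℝ} (hf : ContMDiff I 𝓘(ℝ, ℝ) ∞ f) (hX : SmoothField I X) :
    SmoothField I (f • X) :=
  ContMDiff.smul_section hf hX

lemma isManifold_minSmoothness (n : ℕ) : IsManifold I (minSmoothness ℝ n) M := by
  rw [minSmoothness_of_isRCLikeNormedField]
  infer_instance

lemma SmoothField.mlieBracket [CompleteSpace E] (hX : SmoothField I X) (hY : SmoothField I Y) :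
    SmoothField I (VectorField.mlieBracket I X Y) :=
  fun x ↦
    have : IsManifold I (minSmoothness ℝ 2) M := isManifold_minSmoothness 2
    have : IsManifold I (∞ + 1) M := inferInstanceAs (IsManifold I ∞ M)
    ContMDiffAt.mlieBracket_vectorField (m := ⊤) (n := ⊤) (hX x) (hY x) (by simp)

/-- Every tangent vector is the value of a global smooth field which coincides near the base point
with the local extension `FiberBundle.extend`. -/
lemma exists_smoothField_eventuallyEq_extend [T2Space M] [FiniteDimensional ℝ E] (x : M)
    (v : TangentSpace I x) :
    ∃ V : ∀ x : M, TangentSpace I x, SmoothField I V ∧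
      V =ᶠ[𝓝 x] (FiberBundle.extend E v : ∀ x : M, TangentSpace I x) := by
  obtain ⟨s, hs, hsm⟩ := FiberBundle.exists_contMDiffOn_extend I (k := ∞) E v
  obtain ⟨t, hts, hto, hxt⟩ := mem_nhds_iff.1 hs
  obtain ⟨f, hf⟩ : ∃ f : SmoothBumpFunction I x, tsupport f ⊆ t := by
    have := (SmoothBumpFunction.nhds_basis_tsupport (I := I) x).mem_iff.1 (hto.mem_nhds hxt)
    simpa using this
  refine ⟨fun y ↦ f y • FiberBundle.extend E v y, ?_, ?_⟩
  · exact ContMDiffOn.smul_section_of_tsupport f.contMDiff.contMDiffOn hto hf (hsm.mono hts)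
  · filter_upwards [f.eventuallyEq_one] with y hy
    simp [hy]
    rfl

lemma mdifferentiableAt_congr_field {x : M} (h : X =ᶠ[𝓝 x] Y) (hX : MDiffAt (T% X) x) :
    MDiffAt (T% Y) x :=
  hX.congr_of_eventuallyEq (h.mono fun y hy ↦ by simp [hy])

/-- The commutator formula `[X, Y] f = X (Y f) - Y (X f)`. -/
lemma mvfderiv_mlieBracket [T2Space M] [FiniteDimensional ℝ E] {f : M → ℝ}
    (hf : ContMDiff I 𝓘(ℝ, ℝ) ∞ f) (hX : SmoothField I X) (hY : SmoothField I Y) {x : M}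
    (hXf : MDiffAt (fun y ↦ mvfderiv I f y (X y)) x)
    (hYf : MDiffAt (fun y ↦ mvfderiv I f y (Y y)) x) :
    mvfderiv I f x (VectorField.mlieBracket I X Y x) =
      mvfderiv I (fun y ↦ mvfderiv I f y (Y y)) x (X x) -
        mvfderiv I (fun y ↦ mvfderiv I f y (X y)) x (Y x) := by
  have : CompleteSpace E := FiniteDimensional.complete ℝ E
  -- A nonvanishing `W x` is needed to read off a scalar coefficient; on a zero tangent space both
  -- sides are 0.
  by_cases hw : ∃ w : TangentSpace I x, w ≠ 0
  swap
  · push Not at hw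
    simp [hw]
  obtain ⟨w, hw⟩ := hw
  obtain ⟨W, hW, hWw⟩ := exists_smoothField_eventuallyEq_extend x w
  have hWx : W x ≠ 0 := by simpa [hWw.self_of_nhds] using hw
  have hfx (y : M) : MDiffAt f y := (hf y).mdifferentiableAt (by simp)
  have key {U : ∀ x : M, TangentSpace I x} : VectorField.mlieBracket I U (f • W) =
      (fun y ↦ mvfderiv I f y (U y)) • W + f • VectorField.mlieBracket I U W := by
    ext1 y
    exact VectorField.mlieBracket_smul_right (hfx y) (hW.mdifferentiableAt y)
  have : IsManifold I (minSmoothness ℝ 2) M := isManifold_minSmoothness 2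
  have : IsManifold I (minSmoothness ℝ 3) M := isManifold_minSmoothness 3
  have hmin : minSmoothness ℝ 2 ≤ ∞ := by
    rw [minSmoothness_of_isRCLikeNormedField]
    exact ENat.LEInfty.out
  -- Compare the Jacobi identity for `X, Y, f W` with `f` times that for `X, Y, W`: what remains is
  -- the commutator formula multiplied by `W`.
  have J1 := VectorField.leibniz_identity_mlieBracket_apply ((hX x).of_le hmin)
    ((hY x).of_le hmin) (((hW.smul hf) x).of_le hmin)
  have J2 := VectorField.leibniz_identity_mlieBracket_apply ((hX x).of_le hmin)
    ((hY x).of_le hmin) ((hW x).of_le hmin)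
  have hWd := hW.mdifferentiableAt x
  have expand {U V : ∀ x : M, TangentSpace I x} (hV : SmoothField I V)
      (hVf : MDiffAt (fun y ↦ mvfderiv I f y (V y)) x) :
      VectorField.mlieBracket I U (VectorField.mlieBracket I V (f • W)) x =
        (mvfderiv I (fun y ↦ mvfderiv I f y (V y)) x (U x) • W x +
          mvfderiv I f x (V x) • VectorField.mlieBracket I U W x) +
        (mvfderiv I f x (U x) • VectorField.mlieBracket I V W x +
          f x • VectorField.mlieBracket I U (VectorField.mlieBracket I V W) x) := by
    have hVW := (hV.mlieBracket hW).mdifferentiableAt x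
    rw [key, VectorField.mlieBracket_add_right (hVf.smul_section hWd)
      ((hfx x).smul_section hVW), VectorField.mlieBracket_smul_right hVf hWd,
      VectorField.mlieBracket_smul_right (hfx x) hVW]
  rw [expand hY hYf, expand hX hXf, J2, key] at J1
  simp only [Pi.add_apply, Pi.smul_apply'] at J1
  have : (mvfderiv I f x (VectorField.mlieBracket I X Y x) -
      (mvfderiv I (fun y ↦ mvfderiv I f y (Y y)) x (X x) -
        mvfderiv I (fun y ↦ mvfderiv I f y (X y)) x (Y x))) • W x = 0 := by
    rw [← sub_eq_zero] at J1
    rw [← neg_eq_zero, ← J1]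
    module
  exact sub_eq_zero.1 ((smul_eq_zero.1 this).resolve_right hWx)

variable {D : CovariantDerivative I E (TangentSpace I : M → Type _)}

lemma SmoothField.nabla (hD : CovariantDerivative.ContMDiffCovariantDerivative D ∞)
    (hX : SmoothField I X) (hY : SmoothField I Y) : SmoothField I (nabla D X Y) := by
  have h := hD.contMDiff.contMDiff (σ := Y) (ContMDiff.contMDiffOn hY)
  rw [contMDiffOn_univ] at h
  exact fun x ↦ ContMDiffAt.clm_bundle_apply (h x) (hX x)

lemma connection_congr {x : M} (h : X =ᶠ[𝓝 x] Y) (hX : MDiffAt (T% X) x) : D X x = D Y x :=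
  D.isCovariantDerivativeOn.congr_of_eventuallyEq (s := Set.univ) hX
    (mdifferentiableAt_congr_field h hX) Filter.univ_mem h

/-- The curvature at a point depends only on the germs of the fields. -/
lemma curvature_congr (hD : CovariantDerivative.ContMDiffCovariantDerivative D ∞)
    {X' Y' Z' : ∀ x : M, TangentSpace I x} {x : M}
    (hX : SmoothField I X) (hY : SmoothField I Y) (hZ : SmoothField I Z)
    (hXX' : X =ᶠ[𝓝 x] X') (hYY' : Y =ᶠ[𝓝 x] Y') (hZZ' : Z =ᶠ[𝓝 x] Z') :
    curvature D X Y Z x = curvature D X' Y' Z' x := by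
  have hn {U U' : ∀ x : M, TangentSpace I x} (hUU' : U =ᶠ[𝓝 x] U') :
      Kenmotsu.nabla D U Z =ᶠ[𝓝 x] Kenmotsu.nabla D U' Z' := by
    filter_upwards [hUU', hZZ'.eventuallyEq_nhds] with y hy hzy
    simp only [Kenmotsu.nabla, hy, connection_congr hzy (hZ.mdifferentiableAt y)]
    rfl
  simp only [curvature, Pi.sub_apply, Kenmotsu.nabla]
  rw [← hXX'.self_of_nhds, ← hYY'.self_of_nhds, ← hXX'.mlieBracket_vectorField_eq hYY',
    ← connection_congr hZZ' (hZ.mdifferentiableAt x)]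
  rw [← connection_congr (hn hXX') ((hX.nabla hD hZ).mdifferentiableAt x),
    ← connection_congr (hn hYY') ((hY.nabla hD hZ).mdifferentiableAt x)]

section Metric

variable [RiemannianBundle (fun x : M ↦ TangentSpace I x)]

section

variable [FiniteDimensional ℝ E] [CompleteSpace E]

lemma IsLeviCivita.mvfderiv_inner (hD : IsLeviCivita D) (hY : SmoothField I Y)
    (hZ : SmoothField I Z) (x : M) (v : TangentSpace I x) :
    mvfderiv I (fun y ↦ (inner ℝ (Y y) (Z y) : ℝ)) x v =
      inner ℝ (D Y x v) (Z x) + inner ℝ (Y x) (D Z x v) :=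
  hD.metric x v Y Z (hY.mdifferentiableAt x) (hZ.mdifferentiableAt x)

lemma IsLeviCivita.mlieBracket_eq (hD : IsLeviCivita D) (hX : SmoothField I X)
    (hY : SmoothField I Y) (x : M) :
    VectorField.mlieBracket I X Y x = nabla D X Y x - nabla D Y X x :=
  (D.torsion_eq_zero_iff.1 hD.torsion_free (hX.mdifferentiableAt x) (hY.mdifferentiableAt x)).symm

end

variable [IsContMDiffRiemannianBundle I ∞ E (fun x : M ↦ TangentSpace I x)]

lemma SmoothField.contMDiff_inner (hX : SmoothField I X) (hY : SmoothField I Y) :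
    ContMDiff I 𝓘(ℝ, ℝ) ∞ (fun y ↦ (inner ℝ (X y) (Y y) : ℝ)) :=
  ContMDiff.inner_bundle hX hY

lemma SmoothField.mdifferentiableAt_inner (hX : SmoothField I X) (hY : SmoothField I Y) (x : M) :
    MDiffAt (fun y ↦ (inner ℝ (X y) (Y y) : ℝ)) x :=
  ((hX.contMDiff_inner hY) x).mdifferentiableAt (by simp)

variable [FiniteDimensional ℝ E] [CompleteSpace E]

/-- The curvature of a metric connection is skew-adjoint. -/
lemma IsLeviCivita.inner_curvature_left [T2Space M] (hD : IsLeviCivita D) (hX : SmoothField I X)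
    (hY : SmoothField I Y) (hZ : SmoothField I Z) (hW : SmoothField I W) (x : M) :
    (inner ℝ (curvature D X Y Z x) (W x) : ℝ) = - inner ℝ (Z x) (curvature D X Y W x) := by
  have der (U : ∀ x : M, TangentSpace I x) :
      (fun y ↦ mvfderiv I (fun y ↦ (inner ℝ (Z y) (W y) : ℝ)) y (U y)) =
      fun y ↦ inner ℝ (nabla D U Z y) (W y) + inner ℝ (Z y) (nabla D U W y) := by
    ext y
    exact hD.mvfderiv_inner hZ hW y _
  have d1 {U : ∀ x : M, TangentSpace I x} (hU : SmoothField I U) :=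
    (hU.nabla hD.smooth hZ).mdifferentiableAt_inner hW x
  have d2 {U : ∀ x : M, TangentSpace I x} (hU : SmoothField I U) :=
    hZ.mdifferentiableAt_inner (hU.nabla hD.smooth hW) x
  have second {U V : ∀ x : M, TangentSpace I x} (hV : SmoothField I V) :
      mvfderiv I (fun y ↦ mvfderiv I (fun y ↦ (inner ℝ (Z y) (W y) : ℝ)) y (V y)) x (U x) =
        inner ℝ (nabla D U (nabla D V Z) x) (W x) + inner ℝ (nabla D V Z x) (nabla D U W x) +
        (inner ℝ (nabla D U Z x) (nabla D V W x) + inner ℝ (Z x) (nabla D U (nabla D V W) x)) := by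
    rw [der V, mvfderiv_fun_add (d1 hV) (d2 hV), add_apply,
      hD.mvfderiv_inner (hV.nabla hD.smooth hZ) hW,
      hD.mvfderiv_inner hZ (hV.nabla hD.smooth hW)]
    rfl
  have h := mvfderiv_mlieBracket (hZ.contMDiff_inner hW) hX hY (x := x)
    (by rw [der X]; exact (d1 hX).add (d2 hX)) (by rw [der Y]; exact (d1 hY).add (d2 hY))
  rw [second hX, second hY, hD.mvfderiv_inner hZ hW] at h
  simp only [curvature, Pi.sub_apply, inner_sub_left, inner_sub_right]
  simp only [nabla] at h ⊢
  linarith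

lemma IsLeviCivita.inner_curvatureAt_left [T2Space M] (hD : IsLeviCivita D) {x : M}
    (u v w z : TangentSpace I x) :
    (inner ℝ (curvatureAt D x u v w) z : ℝ) = - inner ℝ w (curvatureAt D x u v z) := by
  obtain ⟨U, hU, hUu⟩ := exists_smoothField_eventuallyEq_extend x u
  obtain ⟨V, hV, hVv⟩ := exists_smoothField_eventuallyEq_extend x v
  obtain ⟨W, hW, hWw⟩ := exists_smoothField_eventuallyEq_extend x w
  obtain ⟨Z, hZ, hZz⟩ := exists_smoothField_eventuallyEq_extend x z
  have hWx : W x = w := hWw.self_of_nhds.trans (FiberBundle.extend_apply_self ..)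
  have hZx : Z x = z := hZz.self_of_nhds.trans (FiberBundle.extend_apply_self ..)
  have h := hD.inner_curvature_left hU hV hW hZ x
  rwa [curvature_congr hD.smooth hU hV hW hUu hVv hWw,
    curvature_congr hD.smooth hU hV hZ hUu hVv hZz, hWx, hZx] at h

/-- Skew-adjointness moves the third argument into a bare inner product, where linearity is evident.
-/
lemma IsLeviCivita.curvatureAt_add [T2Space M] (hD : IsLeviCivita D) {x : M}
    (u v w z : TangentSpace I x) :
    curvatureAt D x u v (w + z) = curvatureAt D x u v w + curvatureAt D x u v z :=
  ext_inner_right ℝ fun y ↦ by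
    simp only [inner_add_left, hD.inner_curvatureAt_left]
    ring

lemma IsLeviCivita.curvatureAt_smul [T2Space M] (hD : IsLeviCivita D) {x : M} (c : ℝ)
    (u v w : TangentSpace I x) :
    curvatureAt D x u v (c • w) = c • curvatureAt D x u v w :=
  ext_inner_right ℝ fun y ↦ by
    simp only [inner_smul_left, hD.inner_curvatureAt_left, mul_neg]

/-- The curvature at `x` may be computed with any smooth fields, of which the first two agree near
`x` with the local extensions of their values. -/
lemma IsLeviCivita.curvatureAt_eq [T2Space M] (hD : IsLeviCivita D) {x : M}
    {u v : TangentSpace I x} (hX : SmoothField I X) (hY : SmoothField I Y) (hZ : SmoothField I Z)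
    (hXu : X =ᶠ[𝓝 x] (FiberBundle.extend E u : ∀ x : M, TangentSpace I x))
    (hYv : Y =ᶠ[𝓝 x] (FiberBundle.extend E v : ∀ x : M, TangentSpace I x)) :
    curvatureAt D x u v (Z x) = curvature D X Y Z x := by
  refine ext_inner_right ℝ fun w ↦ ?_
  obtain ⟨W, hW, hWw⟩ := exists_smoothField_eventuallyEq_extend x w
  have hWx : W x = w := hWw.self_of_nhds.trans (FiberBundle.extend_apply_self ..)
  -- After moving the curvature onto `W`, only the value `Z x` enters.
  rw [hD.inner_curvatureAt_left, ← hWx, hD.inner_curvature_left hX hY hZ hW, hWx,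
    curvature_congr hD.smooth hX hY hW hXu hYv hWw]
  rfl

lemma IsLeviCivita.ricci_add [T2Space M] (hD : IsLeviCivita D) {x : M}
    (u v w : TangentSpace I x) : ricci D x u (v + w) = ricci D x u v + ricci D x u w := by
  simp only [ricci, hD.curvatureAt_add, inner_add_left, Finset.sum_add_distrib]

lemma IsLeviCivita.ricci_smul [T2Space M] (hD : IsLeviCivita D) {x : M} (c : ℝ)
    (u v : TangentSpace I x) : ricci D x u (c • v) = c * ricci D x u v := by
  simp only [ricci, hD.curvatureAt_smul, inner_smul_left, Finset.mul_sum, RCLike.conj_to_real]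

end Metric

end

end Kenmotsu

end

/-! ### Curvature and Ricci tensor of β-Kenmotsu manifolds. -/

noncomputable section

namespace Kenmotsu

open scoped Topology

section

variable {E : Type*} [NormedAddCommGroup E] [NormedSpace ℝ E]
  {H : Type*} [TopologicalSpace H] {I : ModelWithCorners ℝ E H}
  {M : Type*} [TopologicalSpace M] [ChartedSpace H M] [IsManifold I ∞ M]
  {X Y : ∀ x : M, TangentSpace I x}
  [RiemannianBundle (fun x : M ↦ TangentSpace I x)]

lemma AlmostContactMetric.inner_xi_xi (A : AlmostContactMetric I M) (x : M) :
    (inner ℝ (A.xi x) (A.xi x) : ℝ) = 1 := by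
  rw [← A.eta_eq, A.eta_xi]

variable [FiniteDimensional ℝ E] [CompleteSpace E]
  {D : CovariantDerivative I E (TangentSpace I : M → Type _)}
  {A : AlmostContactMetric I M} {β : ℝ}

/-- On a `β`-Kenmotsu manifold, `∇_v ξ = β (v - η(v) ξ)`. -/
lemma IsBetaKenmotsu.connection_xi [T2Space M] (hK : IsBetaKenmotsu D A β) (x : M)
    (v : TangentSpace I x) : D A.xi x v = β • (v - A.eta x v • A.xi x) := by
  obtain ⟨-, hK⟩ := hK
  obtain ⟨V, hV, hVv⟩ := exists_smoothField_eventuallyEq_extend x v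
  have hVx : V x = v := hVv.self_of_nhds.trans (FiberBundle.extend_apply_self ..)
  have h := hK.nabla_phi V A.xi hV A.smooth_xi x
  have hz : (fun y ↦ A.phi y (A.xi y)) = 0 := funext A.phi_xi
  have h0 : (inner ℝ (A.phi x v) (A.xi x) : ℝ) = 0 := by rw [← A.eta_eq, A.eta_phi]
  simp only [nabla, hz, CovariantDerivative.zero, hVx, h0, A.eta_xi] at h
  have h1 : A.phi x (D A.xi x v) = β • A.phi x v := by simpa using h
  -- `φ²` recovers `∇_v ξ` up to its `ξ`-component, which vanishes because `|ξ|` is constant.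
  have h2 := congrArg (A.phi x) h1
  rw [map_smul, A.phi_phi, A.phi_phi] at h2
  have h3 := hK.leviCivita.mvfderiv_inner A.smooth_xi A.smooth_xi x v
  have hc : (fun y ↦ (inner ℝ (A.xi y) (A.xi y) : ℝ)) = fun _ ↦ 1 := funext A.inner_xi_xi
  rw [hc, mvfderiv_const, real_inner_comm (D A.xi x v) (A.xi x), ← A.eta_eq] at h3
  have h4 : A.eta x (D A.xi x v) = 0 := by
    simp at h3
    linarith
  rw [h4, zero_smul, add_zero] at h2
  rw [← neg_inj, h2]
  module

variable [IsContMDiffRiemannianBundle I ∞ E (fun x : M ↦ TangentSpace I x)]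

/-- On a `β`-Kenmotsu manifold, `R(X, Y) ξ = β² (η(X) Y - η(Y) X)`. -/
lemma IsBetaKenmotsu.curvature_xi [T2Space M] (hK : IsBetaKenmotsu D A β)
    (hX : SmoothField I X) (hY : SmoothField I Y) (x : M) :
    curvature D X Y A.xi x = β ^ 2 • (A.eta x (X x) • Y x - A.eta x (Y x) • X x) := by
  have hD := hK.2.leviCivita
  have hsec {U V : ∀ x : M, TangentSpace I x} (hV : SmoothField I V) :
      D (nabla D V A.xi) x (U x) = β • (nabla D U V x -
        ((inner ℝ (nabla D U V x) (A.xi x) +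
          inner ℝ (V x) (β • (U x - A.eta x (U x) • A.xi x)) : ℝ) • A.xi x
          + A.eta x (V x) • β • (U x - A.eta x (U x) • A.xi x))) := by
    -- Writing `η(V)` as `g(V, ξ)` lets metric compatibility differentiate it.
    have e : nabla D V A.xi =
        β • (V - (fun y ↦ (inner ℝ (V y) (A.xi y) : ℝ)) • A.xi) := by
      ext1 y
      simp only [nabla, hK.connection_xi, A.eta_eq]
      rfl
    have hi := hV.contMDiff_inner A.smooth_xi
    have hs := A.smooth_xi.smul hi
    have hadd := D.isCovariantDerivativeOn.add (s := Set.univ) ((hV.sub hs).mdifferentiableAt x)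
      (hs.mdifferentiableAt x)
    rw [sub_add_cancel] at hadd
    have hl := D.isCovariantDerivativeOn.leibniz (s := Set.univ)
      (A.smooth_xi.mdifferentiableAt x) (hV.mdifferentiableAt_inner A.smooth_xi x)
    rw [e, D.isCovariantDerivativeOn.smul_const (s := Set.univ) β
      ((hV.sub hs).mdifferentiableAt x), eq_sub_of_add_eq hadd.symm, hl]
    simp only [smul_apply, sub_apply, add_apply,
      ContinuousLinearMap.smulRight_apply, hD.mvfderiv_inner hV A.smooth_xi, hK.connection_xi,
      A.eta_eq, nabla]
    module
  simp only [curvature, Pi.sub_apply]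
  rw [nabla, nabla, nabla, hsec hX, hsec hY, hK.connection_xi, hD.mlieBracket_eq hX hY]
  simp only [inner_sub_left, inner_sub_right, inner_smul_right, A.eta_eq, real_inner_comm (X x) (Y x)]
  module

/-- The field `ξ` need not be the local extension of its value, so `curvatureAt_eq` is essential. -/
lemma IsBetaKenmotsu.curvatureAt_xi [T2Space M] (hK : IsBetaKenmotsu D A β) (x : M)
    (u v : TangentSpace I x) :
    curvatureAt D x u v (A.xi x) = β ^ 2 • (A.eta x u • v - A.eta x v • u) := by
  obtain ⟨U, hU, hUu⟩ := exists_smoothField_eventuallyEq_extend x u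
  obtain ⟨V, hV, hVv⟩ := exists_smoothField_eventuallyEq_extend x v
  have hUx : U x = u := hUu.self_of_nhds.trans (FiberBundle.extend_apply_self ..)
  have hVx : V x = v := hVv.self_of_nhds.trans (FiberBundle.extend_apply_self ..)
  rw [hK.2.leviCivita.curvatureAt_eq hU hV A.smooth_xi hUu hVv, hK.curvature_xi hU hV, hUx, hVx]

/-- On a `β`-Kenmotsu manifold of dimension `d`, `S(v, ξ) = (1 - d) β² η(v)`. -/
lemma IsBetaKenmotsu.ricci_xi [T2Space M] (hK : IsBetaKenmotsu D A β) (x : M)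
    (v : TangentSpace I x) :
    ricci D x v (A.xi x) = (1 - finrank ℝ E) * β ^ 2 * A.eta x v := by
  let b := stdOrthonormalBasis ℝ (TangentSpace I x)
  have hb : ∑ i, A.eta x (b i) * inner ℝ v (b i) = A.eta x v := by
    rw [A.eta_eq, ← b.sum_inner_mul_inner v (A.xi x)]
    simp only [A.eta_eq, mul_comm]
  have hn (i) : (inner ℝ (b i) (b i) : ℝ) = 1 := by
    rw [real_inner_self_eq_norm_sq, b.norm_eq_one, one_pow]
  calc ricci D x v (A.xi x)
    _ = ∑ i, inner ℝ (β ^ 2 • (A.eta x (b i) • v - A.eta x v • b i)) (b i) := by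
      simp only [ricci, hK.curvatureAt_xi, b]
    _ = ∑ i, (β ^ 2 * (A.eta x (b i) * inner ℝ v (b i)) - β ^ 2 * A.eta x v) := by
      refine Finset.sum_congr rfl fun i _ ↦ ?_
      simp only [inner_smul_left, inner_sub_left, hn, RCLike.conj_to_real]
      ring
    _ = β ^ 2 * A.eta x v - finrank ℝ (TangentSpace I x) * (β ^ 2 * A.eta x v) := by
      rw [Finset.sum_sub_distrib, ← Finset.mul_sum, hb]
      simp
    _ = _ := by
      rw [show finrank ℝ (TangentSpace I x) = finrank ℝ E from rfl]
      ring

/-- On a `β`-Kenmotsu manifold of dimension `d`,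
`(∇_X S)(Y, ξ) = (1 - d) β³ g(X, Y) - β S(Y, X)`. -/
lemma IsBetaKenmotsu.nablaRicci_xi [T2Space M] (hK : IsBetaKenmotsu D A β)
    (hY : SmoothField I Y) (x : M) :
    nablaRicci D X Y A.xi x =
      (1 - finrank ℝ E) * β ^ 3 * inner ℝ (X x) (Y x) - β * ricci D x (Y x) (X x) := by
  have hD := hK.2.leviCivita
  have hf : (fun y ↦ ricci D y (Y y) (A.xi y)) =
      fun y ↦ ((1 - finrank ℝ E) * β ^ 2 : ℝ) • (inner ℝ (Y y) (A.xi y) : ℝ) := by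
    ext y
    rw [hK.ricci_xi, A.eta_eq, smul_eq_mul]
  have hd : mvfderiv I (fun y ↦ ricci D y (Y y) (A.xi y)) x (X x) =
      (1 - finrank ℝ E) * β ^ 2 * (inner ℝ (D Y x (X x)) (A.xi x) +
        inner ℝ (Y x) (D A.xi x (X x))) := by
    rw [hf, mvfderiv_fun_smul mdifferentiableAt_const (hY.mdifferentiableAt_inner A.smooth_xi x),
      mvfderiv_const, ← hD.mvfderiv_inner hY A.smooth_xi]
    simp
  -- Split for linearity of `S` in its second argument; symmetry of `S` is never needed.
  have hs : β • (X x - A.eta x (X x) • A.xi x) = β • X x + (-(β * A.eta x (X x))) • A.xi x := by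
    module
  rw [nablaRicci, hd]
  simp only [nabla, hK.ricci_xi, hK.connection_xi]
  rw [hs, hD.ricci_add, hD.ricci_smul, hD.ricci_smul, hK.ricci_xi, inner_add_right,
    inner_smul_right, inner_smul_right, A.eta_eq, A.eta_eq, A.eta_eq,
    real_inner_comm (X x) (Y x)]
  ring

/-- On a `β`-Kenmotsu manifold of dimension at least `2`, the `1`-form of a special weakly Ricci
symmetric structure vanishes. -/
lemma IsBetaKenmotsu.form_eq_zero [T2Space M] (hK : IsBetaKenmotsu D A β)
    {ρ : ∀ x : M, TangentSpace I x →L[ℝ] ℝ} (hρ : SpecialWeaklyRicciSymmetric D ρ)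
    (hE : 1 < finrank ℝ E) (x : M) : ρ x = 0 := by
  have hk : (1 - finrank ℝ E : ℝ) * β ^ 2 ≠ 0 := by
    refine mul_ne_zero (sub_ne_zero.2 ?_) (pow_ne_zero 2 hK.1.ne')
    exact_mod_cast hE.ne
  -- The left side cancels and the right side is `4 ρ(ξ) S(ξ, ξ)`, with `S(ξ, ξ) ≠ 0`.
  have h0 := hρ.2 A.xi A.xi A.xi A.smooth_xi A.smooth_xi A.smooth_xi x
  rw [hK.nablaRicci_xi A.smooth_xi, hK.ricci_xi, A.eta_xi, A.inner_xi_xi] at h0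
  have hρξ : ρ x (A.xi x) = 0 := by
    refine (mul_eq_zero.1 ?_).resolve_left hk
    linarith
  ext v
  obtain ⟨V, hV, hVv⟩ := exists_smoothField_eventuallyEq_extend x v
  have hVx : V x = v := hVv.self_of_nhds.trans (FiberBundle.extend_apply_self ..)
  -- The left side is again 0; since `ρ(ξ) = 0`, only `ρ(V) S(ξ, ξ)` survives on the right.
  have h1 := hρ.2 A.xi V A.xi A.smooth_xi hV A.smooth_xi x
  rw [hK.nablaRicci_xi hV, hK.ricci_xi, hK.ricci_xi, A.eta_xi, hVx, real_inner_comm,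
    ← A.eta_eq, hρξ] at h1
  refine (mul_eq_zero.1 ?_).resolve_left hk
  linarith

/-- A special weakly Ricci symmetric structure with vanishing `1`-form on a `β`-Kenmotsu manifold
of dimension `d` forces `S = (1 - d) β² g`. -/
lemma IsBetaKenmotsu.ricci_eq_of_form_eq_zero [T2Space M] (hK : IsBetaKenmotsu D A β)
    {ρ : ∀ x : M, TangentSpace I x →L[ℝ] ℝ} (hρ : SpecialWeaklyRicciSymmetric D ρ) {x : M}
    (h0 : ρ x = 0) (u v : TangentSpace I x) :
    ricci D x u v = (1 - finrank ℝ E) * β ^ 2 * inner ℝ u v := by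
  obtain ⟨U, hU, hUu⟩ := exists_smoothField_eventuallyEq_extend x u
  obtain ⟨V, hV, hVv⟩ := exists_smoothField_eventuallyEq_extend x v
  have hUx : U x = u := hUu.self_of_nhds.trans (FiberBundle.extend_apply_self ..)
  have hVx : V x = v := hVv.self_of_nhds.trans (FiberBundle.extend_apply_self ..)
  have h := hρ.2 V U A.xi hV hU A.smooth_xi x
  rw [hK.nablaRicci_xi hU, hUx, hVx, h0, real_inner_comm] at h
  refine mul_left_cancel₀ hK.1.ne' ?_
  simp only [zero_apply] at h
  linarith

/-- A `β`-Kenmotsu manifold of dimension `1` is Ricci flat. -/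
lemma IsBetaKenmotsu.ricci_eq_zero [T2Space M] (hK : IsBetaKenmotsu D A β)
    (hE : finrank ℝ E = 1) (x : M) (u v : TangentSpace I x) : ricci D x u v = 0 := by
  have hξ : A.xi x ≠ 0 := fun h ↦ by simpa [h] using A.inner_xi_xi x
  obtain ⟨c, rfl⟩ := (finrank_eq_one_iff_of_nonzero' (A.xi x) hξ).1
    (show finrank ℝ (TangentSpace I x) = 1 from hE) v
  rw [hK.2.leviCivita.ricci_smul, hK.ricci_xi, hE]
  simp

end

end Kenmotsu

end

theorem proposition2 {n : ℕ} {M : Type*} [TopologicalSpace M] [T2Space M]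
    [ChartedSpace (EuclideanSpace ℝ (Fin (2 * n + 1))) M] [IsManifold (𝓡 (2 * n + 1)) ∞ M]
    [RiemannianBundle (fun x : M ↦ TangentSpace (𝓡 (2 * n + 1)) x)]
    [IsContMDiffRiemannianBundle (𝓡 (2 * n + 1)) ∞ (EuclideanSpace ℝ (Fin (2 * n + 1)))
      (fun x : M ↦ TangentSpace (𝓡 (2 * n + 1)) x)]
    (D : CovariantDerivative (𝓡 (2 * n + 1)) (EuclideanSpace ℝ (Fin (2 * n + 1)))
      (TangentSpace (𝓡 (2 * n + 1)) : M → Type _))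
    (A : Kenmotsu.AlmostContactMetric (𝓡 (2 * n + 1)) M) (β : ℝ)
    (hK : Kenmotsu.IsBetaKenmotsu D A β)
    (ρ : ∀ x : M, TangentSpace (𝓡 (2 * n + 1)) x →L[ℝ] ℝ)
    (hρ : Kenmotsu.SpecialWeaklyRicciSymmetric D ρ) :
    Kenmotsu.IsEinstein D ∧ Kenmotsu.RicciParallel D ∧ (1 ≤ n → ∀ x, ρ x = 0) := by
  have hE : finrank ℝ (EuclideanSpace ℝ (Fin (2 * n + 1))) = 2 * n + 1 := finrank_euclideanSpace_fin
  rcases Nat.eq_zero_or_pos n with hn | hn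
  -- In dimension 1 the form `ρ` is arbitrary, but `S = 0` kills the right side of the condition.
  · have hS := hK.ricci_eq_zero (by rw [hE, hn])
    refine ⟨⟨0, fun x u v ↦ by rw [hS, zero_mul]⟩, fun X Y Z hX hY hZ x ↦ ?_, fun h ↦ by omega⟩
    rw [hρ.2 X Y Z hX hY hZ x, hS, hS, hS]
    simp
  · have h0 := hK.form_eq_zero hρ (by omega)
    refine ⟨⟨_, fun x ↦ hK.ricci_eq_of_form_eq_zero hρ (h0 x)⟩, fun X Y Z hX hY hZ x ↦ ?_,
      fun _ ↦ h0⟩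
    rw [hρ.2 X Y Z hX hY hZ x, h0]
    simp
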